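/- An instance of the (soft, uniform) capacitated $k$-median problem consists of a finite set $\mathcal F$ of facility locations, a finite set $\mathcal C$ of $n$ clients, a metric $d$ on $\mathcal F\cup\mathcal C$ (co-located points allowed), and integers $k\ge 0$ and $u\ge 1$. An integral solution opens $y_i\in\mathbb Z_{\ge 0}$ facilities at each location $i$, with $\sum_i y_i\le k$, and assigns every client $j$ to a location $\sigma(j)$ so that at most $u\,y_i$ clients are assigned to each $i$; its cost is $\sum_j d(j,\sigma(j))$. For $p\in\mathbb Z_{\ge 0}$ and real $q\ge 0$ let $f(p,q)=\min\{qu,p\}$ if $q$ is an integer, extended to real $q$ by linear interpolation between consecutive integers. The rectangle LP is: minimize $\sum_{i,j}x_{i,j}\,d(i,j)$ over $x_{i,j},y_i\ge 0$ subject to $\sum_i x_{i,j}=1$ for all $j$, $\sum_i y_i\le k$, and $\sum_{i\in B,\,j\in J}x_{i,j}\le f\bigl(|J|,\sum_{i\in B}y_i\bigr)$ for all $B\subseteq\mathcal F$, $J\subseteq\mathcal C$. The integrality gap on an instance is the optimum integral cost divided by the optimum value of the rectangle LP. For $\alpha>0$, a degree-3 $\alpha$-expander is a finite nonempty 3-regular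 simple graph $G=(V,E)$ such that $|E(S,V\setminus S)|\ge\alpha|S|$ for every $S\subseteq V$ with $|S|\le|V|/2$; such a graph is connected. Its gap instance has, with $u=|V|$: $\mathcal F=V$, $u+1$ clients located at each vertex (so $n=u(u+1)$), the graph metric, capacity $u$, and $k=u+1$. (1) There is an absolute constant $c>0$ such that for every $\alpha>0$ there is $K=K(\alpha)>0$ such that for every degree-3 $\alpha$-expander on $u$ vertices the gap instance has an integral solution, its rectangle LP has a feasible solution of cost at most $Ku$, and every integral solution has cost at least $c\,u\log u$. (2) Consequently, the rectangle LP has integrality gap $\Omega(\log n)$ if the cardinality constraint may not be violated: there are constants $c>0$ and $\alpha>0$ such that for every $N$ there is a degree-3 $\alpha$-expander with $u\ge N$ vertices whose gap instance, with $n=u(u+1)$ clients, has an integral solution and integrality gap at least $c\log n$. -/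

import Mathlib

open Finset
open scoped ENNReal

/-- An instance of the (soft) uniform capacitated `k`-median problem with facility locations `F` and
clients `C`: at most `k` facilities may be opened (several at one location are allowed), each open
facility serves at most `u` clients, and `d` is a metric on `F ∪ C`. Distinct points may be
co-located, so distance `0` between distinct points is allowed. -/
structure CapKMedian (F C : Type*) where
  k : ℕ
  u : ℕ
  u_pos : 0 < u
  d : F ⊕ C → F ⊕ C → ℝ
  d_self : ∀ a, d a a = 0
  d_comm : ∀ a b, d a b = d b a
  d_triangle : ∀ a b c, d a c ≤ d a b + d b c

/-- For a natural number `q`, `rectBound u p q = min (q * u) p`; between consecutive natural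
numbers it is extended in `q` by linear interpolation. -/
noncomputable def rectBound (u p : ℕ) (q : ℝ) : ℝ :=
  if q ≤ (⌊(p : ℝ) / u⌋ : ℝ) then q * u
  else if q < (⌈(p : ℝ) / u⌉ : ℝ) then
    u * (⌊(p : ℝ) / u⌋ : ℝ) + u * Int.fract ((p : ℝ) / u) * (q - (⌊(p : ℝ) / u⌋ : ℝ))
  else p

namespace CapKMedian

variable {F C : Type*} [Fintype F] [Fintype C]

/-- A feasible solution of the rectangle LP. -/
structure RectSolution (I : CapKMedian F C) where
  x : F → C → ℝ
  y : F → ℝ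
  x_nonneg : ∀ i j, 0 ≤ x i j
  y_nonneg : ∀ i, 0 ≤ y i
  connected : ∀ j, ∑ i, x i j = 1
  cardinality : ∑ i, y i ≤ I.k
  rectangle : ∀ (B : Finset F) (J : Finset C),
    ∑ i ∈ B, ∑ j ∈ J, x i j ≤ rectBound I.u J.card (∑ i ∈ B, y i)

/-- The connection cost of a fractional solution. -/
def RectSolution.cost {I : CapKMedian F C} (s : I.RectSolution) : ℝ :=
  ∑ i, ∑ j, s.x i j * I.d (Sum.inl i) (Sum.inr j)

/-- A feasible integral solution: `opened i` facilities are opened at location `i`, at most `k` in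
total, and client `j` is connected to a facility at location `assign j`. The clients connected to
location `i` can be distributed among the facilities there exactly when there are at most
`u * opened i` of them. -/
structure IntegralSolution (I : CapKMedian F C) where
  opened : F → ℕ
  assign : C → F
  cardinality : ∑ i, opened i ≤ I.k
  capacity : ∀ i, Nat.card {j : C // assign j = i} ≤ I.u * opened i

/-- The connection cost of an integral solution. -/
def IntegralSolution.cost {I : CapKMedian F C} (s : I.IntegralSolution) : ℝ :=
  ∑ j, I.d (Sum.inl (s.assign j)) (Sum.inr j)

/-- The optimum value of the rectangle LP (`∞` if it is infeasible). -/
noncomputable def rectOpt (I : CapKMedian F C) : ℝ≥0∞ :=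
  ⨅ s : I.RectSolution, ENNReal.ofReal s.cost

/-- The optimum integral cost (`∞` if there is no integral solution). -/
noncomputable def integralOpt (I : CapKMedian F C) : ℝ≥0∞ :=
  ⨅ s : I.IntegralSolution, ENNReal.ofReal s.cost

/-- The integrality gap of the rectangle LP on the instance `I`. -/
noncomputable def rectGap (I : CapKMedian F C) : ℝ≥0∞ :=
  I.integralOpt / I.rectOpt

end CapKMedian

/-- A degree-3 expander with (edge) expansion constant `α`: a 3-regular graph in which at least
`α * |S|` edges leave every set `S` of at most half of the vertices. -/
structure IsCubicExpander {V : Type*} [Fintype V] [DecidableEq V] (G : SimpleGraph V)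
    [DecidableRel G.Adj] (α : ℝ) : Prop where
  regular : G.IsRegularOfDegree 3
  expansion : ∀ S : Finset V, 2 * S.card ≤ Fintype.card V →
    α * S.card ≤ ((G.interedges S Sᶜ).card : ℝ)

/-- The gap instance: every vertex of the connected graph `G` is a facility location carrying
`|V| + 1` clients, distances are those of the graph metric, facilities have capacity `|V|`, and
`|V| + 1` facilities may be opened. -/
noncomputable def gapInstance {V : Type*} [Fintype V] [Nonempty V] (G : SimpleGraph V)
    (hG : G.Connected) : CapKMedian V (V × Fin (Fintype.card V + 1)) where
  k := Fintype.card V + 1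
  u := Fintype.card V
  u_pos := Fintype.card_pos
  d a b := (G.dist (Sum.elim id Prod.fst a) (Sum.elim id Prod.fst b) : ℝ)
  d_self a := by simp
  d_comm a b := by rw [SimpleGraph.dist_comm]
  d_triangle a b c := by exact_mod_cast hG.dist_triangle

theorem IsCubicExpander.connected {V : Type*} [Fintype V] [DecidableEq V] [Nonempty V]
    {G : SimpleGraph V} [DecidableRel G.Adj] {α : ℝ} (h : IsCubicExpander G α) (hα : 0 < α) :
    G.Connected := by
  classical
  have key : ∀ S : Finset V, S.Nonempty → 2 * S.card ≤ Fintype.card V →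
      ∃ a ∈ S, ∃ b ∉ S, G.Adj a b := by
    intro S hS hc
    have h1 := h.expansion S hc
    have h2 : (0 : ℝ) < S.card := by exact_mod_cast hS.card_pos
    have h3 : 0 < (G.interedges S Sᶜ).card := by
      exact_mod_cast lt_of_lt_of_le (mul_pos hα h2) h1
    obtain ⟨⟨a, b⟩, hab⟩ := Finset.card_pos.1 h3
    rw [SimpleGraph.mem_interedges_iff] at hab
    exact ⟨a, hab.1, b, by simpa using hab.2.1, hab.2.2⟩
  refine ⟨fun v w => ?_⟩
  by_contra hvw
  let S : Finset V := Finset.univ.filter fun z => G.Reachable v z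
  have hvS : v ∈ S := by simp [S]
  have hwS : w ∈ Sᶜ := by simpa [S] using hvw
  have hcard : S.card + Sᶜ.card = Fintype.card V := Finset.card_add_card_compl S
  rcases le_total S.card Sᶜ.card with hle | hle
  · obtain ⟨a, ha, b, hb, hab⟩ := key S ⟨v, hvS⟩ (by omega)
    simp only [S, Finset.mem_filter, Finset.mem_univ, true_and] at ha hb
    exact hb (ha.trans hab.reachable)
  · obtain ⟨a, ha, b, hb, hab⟩ := key Sᶜ ⟨w, hwS⟩ (by omega)
    simp only [S, Finset.mem_compl, Finset.mem_filter, Finset.mem_univ, true_and,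
      not_not] at ha hb
    exact ha (hb.trans hab.symm.reachable)

/-!
Write `u` for the number of vertices of a cubic `α`-expander.

*Lower bound.* An integral solution opens exactly `u + 1` facilities and uses all of them to
capacity. If `D` is the set of locations with at least two facilities and `Z` the set of locations
with none, then `#D ≤ #Z + 1`. The distance `φ` to `D` is `1`-Lipschitz, so the cost is at least
`∑ v, φ v * (u + 1 - u * opened v)` (`CapKMedian.IntegralSolution.sum_potential_le_cost`), which is
at least `∑ v, φ v + u * #Z`. If `#D` exceeds about `log u`, the second term is large. Otherwise
neighbourhoods of `D` grow at most by a factor of `4` per step, so `φ` is at least of order `log u`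
on half of the vertices (`CapKMedian.IntegralSolution.le_cost`).

*Fractional solution.* Every location is opened to the extent `1 + 1 / u`, and a client at `v` is
served according to one step of a lazy random walk from `v` that leaves `v` with probability of
order `1 / (α * u)`; this costs `O(u)`. For a set `B` of `b` locations, the rectangle bound as a
function of `p = #J` is the minimum of `p`, `b * (u + 1)` and the chord `b * (p / u + u - b)`. The
first two bounds hold for every doubly stochastic matrix. The third is invariant under complementing
both `B` and `J` (`rectMass_le_of_two_mul_card_le`), so only sets `B` of at most half of the vertices
matter, and for these it follows from expansion, which gives `B` many outer neighbours
(`rectMass_lazyWalk_le`). When `u` is small compared with `1 / α`, the uniform matrix serves instead.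

*Expanders.* A union bound over pairs of sets shows that some ten permutations of `2 * m` points
expand all sets of at most `m` points (`exists_perm_card_lt_card_biUnion_image`). They define a
bipartite `10`-regular multigraph. Replacing each of its vertices by a cycle of length `10` gives a
simple cubic graph (`cloudGraph`), to which expansion passes at the loss of a constant factor
(`card_le_card_interedges_cloudGraph`). With the first two parts this gives gap `Ω(log n)`.
-/

/-! ### Integral solutions are expensive -/

namespace SimpleGraph

variable {V : Type*} [Fintype V] [DecidableEq V] {G : SimpleGraph V} [DecidableRel G.Adj]

/-- In a graph of degree at most `Δ`, the `r`-neighbourhood of a set `D` has at most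
`#D * (Δ + 1) ^ r` elements. -/
theorem Connected.card_filter_inf'_dist_le (hG : G.Connected) {Δ : ℕ} (hΔ : ∀ v, G.degree v ≤ Δ)
    {D : Finset V} (hD : D.Nonempty) (r : ℕ) :
    #{v | D.inf' hD (G.dist v) ≤ r} ≤ #D * (Δ + 1) ^ r := by
  induction r with
  | zero =>
    rw [pow_zero, mul_one]
    refine card_le_card fun v hv => ?_
    simp only [mem_filter_univ, inf'_le_iff, Nat.le_zero] at hv
    obtain ⟨a, ha, hva⟩ := hv
    rwa [hG.dist_eq_zero_iff.1 hva]
  | succ r ih =>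
    have hsub : ({v | D.inf' hD (G.dist v) ≤ r + 1} : Finset V) ⊆
        ({v | D.inf' hD (G.dist v) ≤ r} : Finset V).biUnion
          fun v => insert v (G.neighborFinset v) := by
      intro v hv
      simp only [mem_filter_univ, inf'_le_iff] at hv
      obtain ⟨a, ha, hva⟩ := hv
      simp only [mem_biUnion, mem_filter_univ, inf'_le_iff, mem_insert, mem_neighborFinset]
      obtain ⟨p, hp⟩ := hG.exists_walk_length_eq_dist v a
      cases p with
      | nil => exact ⟨v, ⟨v, ha, by simp⟩, Or.inl rfl⟩
      | @cons _ w _ h q =>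
        refine ⟨w, ⟨a, ha, ?_⟩, Or.inr h.symm⟩
        have := G.dist_le q
        rw [Walk.length_cons] at hp
        omega
    calc _ ≤ _ := card_le_card hsub
      _ ≤ #{v | D.inf' hD (G.dist v) ≤ r} * (Δ + 1) := by
        refine card_biUnion_le_card_mul _ _ _ fun v _ => ?_
        refine (card_insert_le _ _).trans ?_
        rw [card_neighborFinset_eq_degree]
        exact Nat.succ_le_succ (hΔ v)
      _ ≤ #D * (Δ + 1) ^ r * (Δ + 1) := Nat.mul_le_mul_right _ ih
      _ = _ := by ring

end SimpleGraph

theorem CapKMedian.IntegralSolution.card_assign_le {F C : Type*} [Fintype F] [Fintype C]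
    [DecidableEq F] {I : CapKMedian F C} (s : I.IntegralSolution) (i : F) :
    #{j | s.assign j = i} ≤ I.u * s.opened i := by
  have h := s.capacity i
  rwa [Nat.card_eq_fintype_card, Fintype.card_subtype] at h

/-- Weak duality for transportation: a nonnegative `1`-Lipschitz potential bounds the cost of an
integral solution from below. -/
theorem CapKMedian.IntegralSolution.sum_potential_le_cost {V : Type*} [Fintype V] [DecidableEq V]
    [Nonempty V] {G : SimpleGraph V} {hG : G.Connected} (s : (gapInstance G hG).IntegralSolution)
    {φ : V → ℝ} (hφ : ∀ v, 0 ≤ φ v) (hlip : ∀ v w, φ v - φ w ≤ G.dist w v) :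
    ∑ v, φ v * ((Fintype.card V + 1 : ℝ) - Fintype.card V * s.opened v) ≤ s.cost := by
  have hassign : ∑ j, φ (s.assign j) ≤ ∑ v, φ v * (Fintype.card V * s.opened v : ℝ) := by
    rw [← Finset.sum_fiberwise univ s.assign]
    refine sum_le_sum fun v _ => ?_
    rw [sum_congr rfl (g := fun _ => φ v) fun j hj => by rw [(mem_filter.1 hj).2], sum_const,
      nsmul_eq_mul, mul_comm]
    refine mul_le_mul_of_nonneg_left ?_ (hφ v)
    exact_mod_cast s.card_assign_le v
  have hclient : ∑ j : V × Fin (Fintype.card V + 1), φ j.1 =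
      ∑ v, φ v * (Fintype.card V + 1 : ℝ) := by
    rw [Fintype.sum_prod_type]
    refine sum_congr rfl fun v _ => ?_
    simp [mul_comm]
  have hcost : ∑ j : V × Fin (Fintype.card V + 1), (φ j.1 - φ (s.assign j)) ≤ s.cost :=
    sum_le_sum fun j _ => hlip _ _
  rw [sum_sub_distrib, hclient] at hcost
  simp only [mul_sub, sum_sub_distrib]
  linarith

theorem two_mul_succ_log_mul_four_pow_le {n : ℕ} (hn : 2 ≤ n) :
    2 * ((Nat.log 16 n + 1) * 4 ^ Nat.log 16 n) ≤ n := by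
  have hpow : 16 ^ Nat.log 16 n ≤ n := Nat.pow_log_le_self 16 (by omega)
  rcases Nat.eq_zero_or_pos (Nat.log 16 n) with h | h
  · simpa [h] using hn
  · obtain ⟨r, hr⟩ := Nat.exists_eq_succ_of_ne_zero h.ne'
    rw [hr] at hpow ⊢
    have h2 : ∀ r : ℕ, 2 * (r + 1 + 1) ≤ 4 ^ (r + 1) := by
      intro r
      induction r with
      | zero => norm_num
      | succ r ih => rw [pow_succ]; omega
    calc 2 * ((r + 1 + 1) * 4 ^ (r + 1)) = 2 * (r + 1 + 1) * 4 ^ (r + 1) := by ring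
      _ ≤ 4 ^ (r + 1) * 4 ^ (r + 1) := Nat.mul_le_mul_right _ (h2 r)
      _ = 16 ^ (r + 1) := by rw [← mul_pow]; norm_num
      _ ≤ n := hpow

/-- Every integral solution of the gap instance on a graph of maximum degree `3` costs
`Ω(|V| log |V|)`: either many locations are closed, and all their clients leave, or few locations
have two facilities, most vertices are at logarithmic distance from these, and every vertex with
one facility has a surplus client. -/
theorem CapKMedian.IntegralSolution.le_cost {V : Type*} [Fintype V] [DecidableEq V]
    [Nonempty V] {G : SimpleGraph V} [DecidableRel G.Adj] {hG : G.Connected}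
    (hdeg : ∀ v, G.degree v ≤ 3) (s : (gapInstance G hG).IntegralSolution) :
    1 / (2 * Real.log 16) * ((Fintype.card V : ℝ) * Real.log (Fintype.card V : ℝ)) ≤ s.cost := by
  set u := Fintype.card V with hu
  have hupos : 0 < u := Fintype.card_pos
  have hcost0 : 0 ≤ s.cost := sum_nonneg fun j _ => Nat.cast_nonneg _
  rcases Nat.lt_or_ge u 2 with hu2 | hu2
  · have : u = 1 := by omega
    simpa [← hu, this] using hcost0
  set D : Finset V := {v | 2 ≤ s.opened v} with hDdef
  set Z : Finset V := {v | s.opened v = 0} with hZdef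
  have hsum : ∑ v, s.opened v ≤ u + 1 := s.cardinality
  have hsum' : u < ∑ v, s.opened v := by
    have h1 : u * (u + 1) ≤ u * ∑ v, s.opened v := by
      rw [mul_sum]
      calc u * (u + 1) = #(univ : Finset (V × Fin (Fintype.card V + 1))) := by simp [hu]
        _ = ∑ v, #{j | s.assign j = v} :=
          card_eq_sum_card_fiberwise fun _ _ => mem_coe.2 (mem_univ _)
        _ ≤ _ := sum_le_sum fun v _ => s.card_assign_le v
    exact Nat.le_of_mul_le_mul_left h1 hupos
  have hD : D.Nonempty := by
    rw [nonempty_iff_ne_empty]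
    intro hempty
    have : ∑ v, s.opened v ≤ ∑ _v : V, 1 := by
      refine sum_le_sum fun v _ => ?_
      by_contra hv
      have : v ∈ D := by rw [hDdef, mem_filter_univ]; omega
      simp [hempty] at this
    rw [sum_const, smul_eq_mul, mul_one, card_univ] at this
    omega
  have hDZ : #D ≤ #Z + 1 := by
    have h1 : ∑ v, (1 + if v ∈ D then 1 else 0) ≤ ∑ v, (s.opened v + if v ∈ Z then 1 else 0) := by
      refine sum_le_sum fun v _ => ?_
      simp only [hDdef, hZdef, mem_filter_univ]
      split_ifs <;> omega
    simp only [sum_add_distrib, sum_boole, sum_const, card_univ, filter_univ_mem, smul_eq_mul,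
      mul_one, Nat.cast_id] at h1
    omega
  set φ : V → ℕ := fun v => D.inf' hD (G.dist v) with hφdef
  have hφD : ∀ v ∈ D, φ v = 0 := fun v hv =>
    Nat.le_zero.1 ((inf'_le _ hv).trans (by simp))
  have hφZ : ∀ v ∈ Z, 1 ≤ φ v := by
    intro v hv
    rw [hφdef, le_inf'_iff]
    intro a ha
    rw [Nat.one_le_iff_ne_zero, Ne, hG.dist_eq_zero_iff]
    rintro rfl
    simp only [hDdef, hZdef, mem_filter_univ] at ha hv
    omega
  have hlip : ∀ v w, (φ v : ℝ) - φ w ≤ G.dist w v := by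
    intro v w
    obtain ⟨a, ha, hwa⟩ := exists_mem_eq_inf' hD (G.dist w)
    have h1 : φ v ≤ G.dist v a := inf'_le _ ha
    have h2 : G.dist v a ≤ G.dist v w + G.dist w a := hG.dist_triangle
    have h3 : φ w = G.dist w a := hwa
    rw [G.dist_comm (u := v) (v := w)] at h2
    rw [sub_le_iff_le_add]
    exact_mod_cast (by omega : φ v ≤ G.dist w v + φ w)
  have hdual := s.sum_potential_le_cost (φ := fun v => (φ v : ℝ)) (fun v => Nat.cast_nonneg _) hlip
  have hlow : ∑ v, (φ v : ℝ) + u * #Z ≤ s.cost := by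
    refine le_trans ?_ hdual
    have : (u * #Z : ℝ) = ∑ v, if v ∈ Z then (u : ℝ) else 0 := by
      simp [mul_comm]
    rw [this, ← sum_add_distrib]
    refine sum_le_sum fun v _ => ?_
    by_cases hvD : v ∈ D
    · have : v ∉ Z := fun hvZ => by have := hφZ v hvZ; rw [hφD v hvD] at this; omega
      simp [hφD v hvD, this]
    · by_cases hvZ : v ∈ Z
      · have h0 : s.opened v = 0 := by simpa [hZdef] using hvZ
        have h1 : (1 : ℝ) ≤ φ v := by exact_mod_cast hφZ v hvZ
        have h2 : (0 : ℝ) ≤ u := Nat.cast_nonneg _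
        simp only [hvZ, if_true, h0, Nat.cast_zero, mul_zero, sub_zero, ← hu]
        nlinarith
      · have h1 : s.opened v = 1 := by
          simp only [hDdef, hZdef, mem_filter_univ] at hvD hvZ
          omega
        simp [hvZ, h1, ← hu]
  set r := Nat.log 16 u with hr
  have hlog16 : 0 < Real.log 16 := Real.log_pos (by norm_num)
  have hlog : Real.log u ≤ (r + 1) * Real.log 16 := by
    have h1 : (u : ℝ) ≤ (16 : ℝ) ^ (r + 1) := by
      exact_mod_cast (Nat.lt_pow_succ_log_self (by norm_num : 1 < 16) u).le
    have h2 := Real.log_le_log (by exact_mod_cast hupos) h1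
    rw [Real.log_pow] at h2
    exact_mod_cast h2
  have hmain : (u * (r + 1) / 2 : ℝ) ≤ s.cost := by
    have hφ0 : (0 : ℝ) ≤ ∑ v, (φ v : ℝ) := sum_nonneg fun _ _ => Nat.cast_nonneg _
    rcases Nat.lt_or_ge #D (r + 2) with hDr | hDr
    · -- With few multiply opened locations, half of the vertices are farther than `r` from all.
      have hball : #{v | φ v ≤ r} ≤ #D * 4 ^ r := hG.card_filter_inf'_dist_le hdeg hD r
      have hb2 : 2 * #{v | φ v ≤ r} ≤ u := by
        refine le_trans ?_ (two_mul_succ_log_mul_four_pow_le hu2)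
        rw [← hr]
        exact Nat.mul_le_mul_left _ (hball.trans (Nat.mul_le_mul_right _ (by omega)))
      have hsplit : #{v | φ v ≤ r} + #{v | ¬ φ v ≤ r} = u :=
        card_filter_add_card_filter_not _
      have hfar : #{v | ¬ φ v ≤ r} * (r + 1) ≤ ∑ v, φ v := by
        rw [← smul_eq_mul]
        refine (card_nsmul_le_sum _ φ _ fun v hv => ?_).trans
          (sum_le_sum_of_subset (filter_subset _ _))
        rw [mem_filter_univ] at hv
        omega
      have hfin : u * (r + 1) ≤ 2 * ∑ v, φ v := by
        calc u * (r + 1) ≤ 2 * #{v | ¬ φ v ≤ r} * (r + 1) := Nat.mul_le_mul_right _ (by omega)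
          _ = 2 * (#{v | ¬ φ v ≤ r} * (r + 1)) := by ring
          _ ≤ _ := Nat.mul_le_mul_left _ hfar
      have hfin' : (u * (r + 1) : ℝ) ≤ 2 * ∑ v, (φ v : ℝ) := by exact_mod_cast hfin
      have : (0 : ℝ) ≤ u * #Z := by positivity
      linarith
    · have hZ : (r + 1 : ℝ) ≤ #Z := by exact_mod_cast (by omega : r + 1 ≤ #Z)
      have h1 : (u * (r + 1) : ℝ) ≤ u * #Z := mul_le_mul_of_nonneg_left hZ (Nat.cast_nonneg _)
      have : (0 : ℝ) ≤ u * (r + 1) := by positivity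
      linarith
  refine le_trans ?_ hmain
  rw [div_mul_eq_mul_div, one_mul, div_le_div_iff₀ (by positivity) (by norm_num)]
  have := mul_le_mul_of_nonneg_left hlog (Nat.cast_nonneg (α := ℝ) u)
  nlinarith

/-! ### Fractional solutions from symmetric stochastic matrices -/

/-- The chord `b * (p / u + u - b)` is the line through the points of the graph of
`p ↦ min p (b * (u + 1))` at `p = b * u` and `p = (b + 1) * u`. The rectangle bound at
`q = b * (u + 1) / u` is the minimum of these three quantities. -/
theorem le_rectBound {u p b : ℕ} (hu : 0 < u) (hb : b ≤ u) {X : ℝ} (hp : X ≤ p)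
    (hbX : X ≤ b * (u + 1)) (hX : X ≤ b * ((p : ℝ) / u + u - b)) :
    X ≤ rectBound u p (b * ((u + 1) / u)) := by
  have hu' : (0 : ℝ) < u := by exact_mod_cast hu
  have hq : (b * ((u + 1) / u) : ℝ) = b + b / u := by field_simp
  have hb0 : (0 : ℝ) ≤ b / u := by positivity
  have hb' : (b : ℝ) ≤ u := by exact_mod_cast hb
  unfold rectBound
  split_ifs with h1 h2
  · convert hbX using 1
    field_simp
  · rw [hq] at h1 h2 ⊢
    rw [not_le] at h1
    have hceil := Int.ceil_le_floor_add_one ((p : ℝ) / u)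
    have hlt : (b + b / u : ℝ) < (⌊(p : ℝ) / u⌋ : ℝ) + 1 := h2.trans_le (by exact_mod_cast hceil)
    have hbu : (b : ℝ) < u := by
      refine hb'.lt_of_ne fun hbu => ?_
      rw [hbu, div_self hu'.ne'] at h1 hlt
      have h3 : ⌊(p : ℝ) / u⌋ < (u : ℤ) + 1 := by exact_mod_cast h1
      have h4 : (u : ℤ) + 1 < ⌊(p : ℝ) / u⌋ + 1 := by exact_mod_cast hlt
      omega
    have hfrac : (b / u : ℝ) < 1 := (div_lt_one hu').2 hbu
    have h3 : ⌊(p : ℝ) / u⌋ < (b : ℤ) + 1 := by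
      have : (⌊(p : ℝ) / u⌋ : ℝ) < b + 1 := by linarith
      exact_mod_cast this
    have h4 : (b : ℤ) < ⌊(p : ℝ) / u⌋ + 1 := by
      have : (b : ℝ) < (⌊(p : ℝ) / u⌋ : ℝ) + 1 := by linarith
      exact_mod_cast this
    have hfl : ⌊(p : ℝ) / u⌋ = (b : ℤ) := by omega
    have hfr : Int.fract ((p : ℝ) / u) = (p : ℝ) / u - b := by
      rw [Int.fract, hfl, Int.cast_natCast]
    rw [hfr, hfl, Int.cast_natCast]
    refine hX.trans_eq ?_
    field_simp
    ring
  · exact hp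

theorem SimpleGraph.Connected.dist_lt_card {V : Type*} [Fintype V] {G : SimpleGraph V}
    (hG : G.Connected) (v w : V) :
    G.dist v w < Fintype.card V := by
  obtain ⟨p, hp, hlen⟩ := hG.exists_path_of_dist v w
  exact hlen ▸ hp.length_lt

section Stochastic

variable {V : Type*} [Fintype V]

/-- Total weight that the clients in `J` receive from the locations in `B` when client `(v, l)` is
served by location `i` to the extent `P i v`. -/
def rectMass (P : V → V → ℝ) (B : Finset V) (J : Finset (V × Fin (Fintype.card V + 1))) : ℝ :=
  ∑ i ∈ B, ∑ j ∈ J, P i j.1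

theorem rectMass_univ_left {P : V → V → ℝ} (hcol : ∀ v, ∑ i, P i v = 1)
    (J : Finset (V × Fin (Fintype.card V + 1))) : rectMass P univ J = #J := by
  rw [rectMass, sum_comm]
  simp [hcol]

theorem rectMass_univ_right {P : V → V → ℝ} (hrow : ∀ i, ∑ v, P i v = 1) (B : Finset V) :
    rectMass P B univ = #B * (Fintype.card V + 1) := by
  simp [rectMass, Fintype.sum_prod_type, ← mul_sum, hrow, mul_add]

theorem rectMass_nonneg {P : V → V → ℝ} (h0 : ∀ i v, 0 ≤ P i v) (B : Finset V)
    (J : Finset (V × Fin (Fintype.card V + 1))) : 0 ≤ rectMass P B J :=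
  sum_nonneg fun _ _ => sum_nonneg fun _ _ => h0 _ _

variable [DecidableEq V]

theorem rectMass_add_compl_left (P : V → V → ℝ) (B : Finset V)
    (J : Finset (V × Fin (Fintype.card V + 1))) :
    rectMass P B J + rectMass P Bᶜ J = rectMass P univ J :=
  sum_add_sum_compl _ _

theorem rectMass_add_compl_right (P : V → V → ℝ) (B : Finset V)
    (J : Finset (V × Fin (Fintype.card V + 1))) :
    rectMass P B J + rectMass P B Jᶜ = rectMass P B univ := by
  simp only [rectMass, ← sum_add_distrib, sum_add_sum_compl]

variable [Nonempty V]

/-- The chord bound on `rectMass P B J` is invariant under complementing both `B` and `J`, so it is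
enough to verify it when `B` contains at most half of the vertices. -/
theorem rectMass_le_of_two_mul_card_le {P : V → V → ℝ} (hrow : ∀ i, ∑ v, P i v = 1)
    (hcol : ∀ v, ∑ i, P i v = 1)
    (h : ∀ B : Finset V, 2 * #B ≤ Fintype.card V → ∀ J,
      rectMass P B J ≤ #B * ((#J : ℝ) / Fintype.card V + Fintype.card V - #B))
    (B : Finset V) (J : Finset (V × Fin (Fintype.card V + 1))) :
    rectMass P B J ≤ #B * ((#J : ℝ) / Fintype.card V + Fintype.card V - #B) := by
  rcases Nat.le_total (2 * #B) (Fintype.card V) with hB | hB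
  · exact h B hB J
  have hBc : #B + #Bᶜ = Fintype.card V := card_add_card_compl B
  have hJc : #J + #Jᶜ = Fintype.card V * (Fintype.card V + 1) := by
    rw [card_add_card_compl, Fintype.card_prod, Fintype.card_fin]
  have h1 := h Bᶜ (by omega) Jᶜ
  have h2 := rectMass_add_compl_left P B J
  have h3 := rectMass_add_compl_right P Bᶜ J
  rw [rectMass_univ_left hcol] at h2
  rw [rectMass_univ_right hrow] at h3
  have hu : (Fintype.card V : ℝ) ≠ 0 := by exact_mod_cast Fintype.card_ne_zero
  have hBc' : (#Bᶜ : ℝ) = Fintype.card V - #B := by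
    rw [eq_sub_iff_add_eq']; exact_mod_cast hBc
  have hJc' : (#Jᶜ : ℝ) = Fintype.card V * (Fintype.card V + 1) - #J := by
    rw [eq_sub_iff_add_eq']; exact_mod_cast hJc
  rw [hBc'] at h1 h3
  rw [hJc'] at h1
  have h4 : ((Fintype.card V : ℝ) - #B) *
      ((Fintype.card V * (Fintype.card V + 1) - #J : ℝ) / Fintype.card V + Fintype.card V -
        (Fintype.card V - #B)) =
      (Fintype.card V - #B) * (Fintype.card V + 1) + #B * ((#J : ℝ) / Fintype.card V +
        Fintype.card V - #B) - #J := by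
    field_simp
    ring
  linarith

/-- A doubly stochastic matrix that satisfies the chord bound gives a solution of the rectangle LP
of the gap instance in which every location is opened to the extent `(|V| + 1) / |V|`. -/
theorem exists_rectSolution_of_rectMass_le {G : SimpleGraph V} (hG : G.Connected)
    {P : V → V → ℝ} (h0 : ∀ i v, 0 ≤ P i v) (hrow : ∀ i, ∑ v, P i v = 1)
    (hcol : ∀ v, ∑ i, P i v = 1)
    (h : ∀ B : Finset V, 2 * #B ≤ Fintype.card V → ∀ J,
      rectMass P B J ≤ #B * ((#J : ℝ) / Fintype.card V + Fintype.card V - #B)) :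
    ∃ s : (gapInstance G hG).RectSolution,
      s.cost = (Fintype.card V + 1) * ∑ i, ∑ v, P i v * G.dist i v := by
  have hu : (Fintype.card V : ℝ) ≠ 0 := by exact_mod_cast Fintype.card_ne_zero
  refine ⟨{ x := fun i j => P i j.1
            y := fun _ => (Fintype.card V + 1) / Fintype.card V
            x_nonneg := fun i j => h0 i j.1
            y_nonneg := fun i => by positivity
            connected := fun j => hcol j.1
            cardinality := ?_
            rectangle := fun B J => ?_ }, ?_⟩
  · rw [sum_const, card_univ, nsmul_eq_mul, mul_div_cancel₀ _ hu]
    simp [gapInstance]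
  · rw [sum_const, nsmul_eq_mul]
    have hJ := rectMass_add_compl_left P B J
    have hB := rectMass_add_compl_right P B J
    rw [rectMass_univ_left hcol] at hJ
    rw [rectMass_univ_right hrow] at hB
    have hJ0 := rectMass_nonneg h0 Bᶜ J
    have hB0 := rectMass_nonneg h0 B Jᶜ
    exact le_rectBound Fintype.card_pos (card_le_univ B) (X := rectMass P B J) (by linarith)
      (by linarith) (rectMass_le_of_two_mul_card_le hrow hcol h B J)
  · simp only [CapKMedian.RectSolution.cost, gapInstance, Fintype.sum_prod_type, Sum.elim_inl,
      Sum.elim_inr, id, sum_const, card_univ, Fintype.card_fin, nsmul_eq_mul, ← mul_sum]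
    push_cast
    rfl

/-- Serving every client uniformly from all locations is a fractional solution. -/
theorem exists_rectSolution_cost_le_pow {G : SimpleGraph V} (hG : G.Connected) :
    ∃ s : (gapInstance G hG).RectSolution,
      s.cost ≤ (Fintype.card V + 1) * (Fintype.card V : ℝ) ^ 2 := by
  have hu : (0 : ℝ) < Fintype.card V := by exact_mod_cast Fintype.card_pos
  have hsum : ∑ _v : V, (1 / Fintype.card V : ℝ) = 1 := by
    rw [sum_const, card_univ, nsmul_eq_mul, mul_one_div_cancel hu.ne']
  obtain ⟨s, hs⟩ := exists_rectSolution_of_rectMass_le hG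
    (P := fun _ _ => (1 / Fintype.card V : ℝ)) (fun _ _ => by positivity) (fun _ => hsum)
    (fun _ => hsum) fun B _ J => by
      have hB : (#B : ℝ) ≤ Fintype.card V := by exact_mod_cast card_le_univ B
      have : (0 : ℝ) ≤ #B * (Fintype.card V - #B) := mul_nonneg (by positivity) (by linarith)
      simp only [rectMass, sum_const, nsmul_eq_mul]
      calc (#B * (#J * (1 / Fintype.card V)) : ℝ) = #B * ((#J : ℝ) / Fintype.card V) := by ring
        _ ≤ _ := by linarith
  refine ⟨s, hs.trans_le (mul_le_mul_of_nonneg_left ?_ (by positivity))⟩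
  calc ∑ i, ∑ v, (1 / Fintype.card V : ℝ) * G.dist i v ≤ ∑ _i : V, ∑ _v : V, (1 : ℝ) := by
        refine sum_le_sum fun i _ => sum_le_sum fun v _ => ?_
        rw [div_mul_eq_mul_div, one_mul, div_le_one hu]
        exact_mod_cast (hG.dist_lt_card i v).le
    _ = _ := by simp [sq]

end Stochastic

/-! ### The lazy random walk on an expander -/

section LazyWalk

variable {V : Type*} [DecidableEq V] {G : SimpleGraph V} [DecidableRel G.Adj]

/-- Transition matrix of the walk on a cubic graph that moves along each edge with
probability `ε`. -/
def lazyWalk (G : SimpleGraph V) [DecidableRel G.Adj] (ε : ℝ) (i v : V) : ℝ :=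
  (if i = v then 1 - 3 * ε else 0) + if G.Adj i v then ε else 0

theorem lazyWalk_comm (ε : ℝ) (i v : V) : lazyWalk G ε i v = lazyWalk G ε v i := by
  simp [lazyWalk, eq_comm, G.adj_comm]

variable [Fintype V]

theorem sum_lazyWalk (hG : G.IsRegularOfDegree 3) (ε : ℝ) (i : V) :
    ∑ v, lazyWalk G ε i v = 1 := by
  have : #{v | G.Adj i v} = 3 := by
    rw [← G.neighborFinset_eq_filter, G.card_neighborFinset_eq_degree, hG.degree_eq]
  simp [lazyWalk, sum_add_distrib, ← sum_filter, this]

theorem sum_lazyWalk_mul_dist (hG : G.IsRegularOfDegree 3) (ε : ℝ) (i : V) :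
    ∑ v, lazyWalk G ε i v * G.dist i v = 3 * ε := by
  have hcard : #{v | G.Adj i v} = 3 := by
    rw [← G.neighborFinset_eq_filter, G.card_neighborFinset_eq_degree, hG.degree_eq]
  have : ∀ v, lazyWalk G ε i v * G.dist i v = if G.Adj i v then ε else 0 := by
    intro v
    by_cases h : G.Adj i v
    · simp [lazyWalk, h, h.ne, SimpleGraph.dist_eq_one_iff_adj.2 h]
    · by_cases hiv : i = v
      · simp [hiv]
      · simp [lazyWalk, h, hiv]
  simp [this, ← sum_filter, hcard]

/-- The vertices outside `B` with a neighbour in `B`. -/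
def outerBoundary (G : SimpleGraph V) [DecidableRel G.Adj] (B : Finset V) : Finset V :=
  {v | v ∉ B ∧ ∃ i ∈ B, G.Adj i v}

theorem card_interedges_compl_le (hG : G.IsRegularOfDegree 3) (B : Finset V) :
    #(G.interedges B Bᶜ) ≤ 3 * #(outerBoundary G B) := by
  refine card_le_mul_card_image_of_maps_to (f := Prod.snd) ?_ 3 ?_
  · rintro ⟨a, b⟩ hab
    rw [SimpleGraph.mk_mem_interedges_iff, mem_compl] at hab
    simp only [outerBoundary, mem_filter_univ]
    exact ⟨hab.2.1, a, hab.1, hab.2.2⟩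
  · intro b _
    rw [← hG.degree_eq b, ← G.card_neighborFinset_eq_degree]
    refine card_le_card_of_injOn Prod.fst ?_ ?_
    · rintro ⟨a, c⟩ hac
      simp only [coe_filter, Set.mem_ofPred_eq, SimpleGraph.mk_mem_interedges_iff] at hac
      obtain ⟨⟨_, _, h⟩, rfl⟩ := hac
      simpa using h.symm
    · rintro ⟨a, c⟩ hac ⟨a', c'⟩ hac' h
      simp only [coe_filter, Set.mem_ofPred_eq] at hac hac' h
      rw [Prod.mk.injEq]
      exact ⟨h, hac.2.trans hac'.2.symm⟩

theorem le_sum_lazyWalk {ε : ℝ} (hε : 0 ≤ ε) (hε' : 6 * ε ≤ 1) (B : Finset V) (v : V) :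
    ((if v ∈ B then 1 / 2 else 0) + if v ∈ outerBoundary G B then ε else 0) ≤
      ∑ i ∈ B, lazyWalk G ε i v := by
  have h0 : ∀ i, 0 ≤ lazyWalk G ε i v := fun i => by
    unfold lazyWalk
    split_ifs <;> linarith
  by_cases hB : v ∈ B
  · have : v ∉ outerBoundary G B := by simp [outerBoundary, hB]
    rw [if_pos hB, if_neg this, add_zero]
    refine le_trans ?_ (single_le_sum (fun i _ => h0 i) hB)
    simp only [lazyWalk, if_true, SimpleGraph.irrefl, if_false]
    linarith
  · rw [if_neg hB, zero_add]
    split_ifs with h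
    · simp only [outerBoundary, mem_filter_univ] at h
      obtain ⟨_, i, hi, hadj⟩ := h
      refine le_trans ?_ (single_le_sum (fun i _ => h0 i) hi)
      simp [lazyWalk, hadj, hadj.ne]
    · exact sum_nonneg fun i _ => h0 i

/-- The chord bound for the lazy walk and at most half of the vertices. By expansion `B` has at least
`max 1 (α * #B / 3)` outer neighbours; each carries `|V| + 1` clients, and those among them outside
`J` receive weight from `B` that the left-hand side misses. -/
theorem rectMass_lazyWalk_le [Nonempty V] {α : ℝ} (hα : 0 < α) (hG : IsCubicExpander G α)
    (hu : 18 / α ≤ Fintype.card V) {B : Finset V} (hB : 2 * #B ≤ Fintype.card V)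
    (J : Finset (V × Fin (Fintype.card V + 1))) :
    rectMass (lazyWalk G (3 / (α * Fintype.card V))) B J ≤
      #B * ((#J : ℝ) / Fintype.card V + Fintype.card V - #B) := by
  rcases B.eq_empty_or_nonempty with rfl | hBne
  · simp [rectMass]
  set ε : ℝ := 3 / (α * Fintype.card V) with hεdef
  set u : ℝ := ((Fintype.card V : ℕ) : ℝ) with hudef
  have hupos : 0 < u := by rw [hudef]; exact_mod_cast Fintype.card_pos
  have hε : 0 ≤ ε := by positivity
  have hε' : 6 * ε ≤ 1 := by
    rw [div_le_iff₀ hα] at hu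
    rw [hεdef, mul_div_assoc', div_le_one (by positivity)]
    linarith
  set N := outerBoundary G B with hN
  have hexp : α * #B ≤ 3 * #N :=
    (hG.expansion B hB).trans (by exact_mod_cast card_interedges_compl_le hG.regular B)
  have hN1 : (1 : ℝ) ≤ #N := by
    have h1 : (0 : ℝ) < #B := by exact_mod_cast hBne.card_pos
    have h2 : (0 : ℝ) < #N := by linarith [mul_pos hα h1]
    exact_mod_cast h2
  -- `a`: clients outside `J` located in `B`; `n'`: those located next to `B`;
  -- `t`: clients in `J` located outside `B`.
  set a := #{j ∈ Jᶜ | j.1 ∈ B} with ha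
  set n' := #{j ∈ Jᶜ | j.1 ∈ N} with hn'
  set t := #{j ∈ J | j.1 ∉ B} with ht
  have hmass : (a / 2 + ε * n' : ℝ) ≤ rectMass (lazyWalk G ε) B Jᶜ := by
    have h1 : (a / 2 + ε * n' : ℝ) = ∑ j ∈ Jᶜ,
        ((if j.1 ∈ B then 1 / 2 else 0) + if j.1 ∈ N then ε else 0) := by
      rw [sum_add_distrib, ← sum_filter, ← sum_filter, sum_const, sum_const, nsmul_eq_mul,
        nsmul_eq_mul, ← ha, ← hn']
      ring
    rw [h1, rectMass, sum_comm]
    exact sum_le_sum fun j _ => le_sum_lazyWalk hε hε' B j.1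
  have hfiber : ∀ S : Finset V,
      #{j : V × Fin (Fintype.card V + 1) | j.1 ∈ S} = #S * (Fintype.card V + 1) := by
    intro S
    have : ({j : V × Fin (Fintype.card V + 1) | j.1 ∈ S} : Finset _) = S ×ˢ univ := by
      ext j; simp
    rw [this, card_product, card_univ, Fintype.card_fin]
  have hn : (#N * (u + 1) : ℝ) ≤ n' + t := by
    have h1 : #{j : V × Fin (Fintype.card V + 1) | j.1 ∈ N} ≤ n' + t := by
      refine (card_le_card (t := {j ∈ Jᶜ | j.1 ∈ N} ∪ {j ∈ J | j.1 ∉ B}) ?_).trans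
        (card_union_le _ _)
      intro j hj
      rw [mem_filter_univ] at hj
      simp only [mem_union, mem_filter, mem_compl]
      by_cases hjJ : j ∈ J
      · refine Or.inr ⟨hjJ, ?_⟩
        simp only [hN, outerBoundary, mem_filter_univ] at hj
        exact hj.1
      · exact Or.inl ⟨hjJ, hj⟩
    rw [hfiber] at h1
    rw [hudef]
    exact_mod_cast h1
  have hJ : (#J + a : ℝ) = #B * (u + 1) + t := by
    have h1 : #{j ∈ J | j.1 ∈ B} + t = #J := card_filter_add_card_filter_not _
    have h2 : #{j ∈ J | j.1 ∈ B} + a = #B * (Fintype.card V + 1) := by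
      rw [← hfiber, ha, ← card_union_of_disjoint
        (disjoint_filter_filter (disjoint_compl_right)), ← filter_union, union_compl]
    have h3 : #J + a = #B * (Fintype.card V + 1) + t := by omega
    rw [hudef]
    exact_mod_cast h3
  have hrow := rectMass_add_compl_right (lazyWalk G ε) B J
  rw [rectMass_univ_right (sum_lazyWalk hG.regular ε), ← hudef] at hrow
  set b : ℝ := ((#B : ℕ) : ℝ) with hb
  have hb0 : 0 ≤ b := Nat.cast_nonneg _
  have hb2 : 2 * b ≤ u := by rw [hb, hudef]; exact_mod_cast hB
  have hbu : b / u ≤ 1 / 2 := by rw [div_le_div_iff₀ hupos two_pos]; linarith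
  have hbu0 : 0 ≤ b / u := by positivity
  have ha0 : (0 : ℝ) ≤ a := Nat.cast_nonneg _
  have ht0 : (0 : ℝ) ≤ t := Nat.cast_nonneg _
  -- Clients in `B` pay for `a`, those next to `B` for `u - b - t`.
  have hkey : b / u * (a + (u - b - t)) ≤ a / 2 + ε * n' := by
    have h1 : b / u * a ≤ a / 2 := by nlinarith
    have h2 : b / u * (u - b - t) ≤ ε * n' := by
      rcases le_total (u - b - t : ℝ) 0 with h | h
      · exact (mul_nonpos_of_nonneg_of_nonpos hbu0 h).trans (by positivity)
      · have h3 : #N * (u - b - t) ≤ (n' : ℝ) := by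
          have h4 : (t : ℝ) * 1 ≤ t * #N := mul_le_mul_of_nonneg_left hN1 ht0
          have h5 : 0 ≤ (#N : ℝ) * (b + 1) := by positivity
          linarith
        calc b / u * (u - b - t) = ε * (α * b / 3 * (u - b - t)) := by
              rw [hεdef]; field_simp
          _ ≤ ε * (#N * (u - b - t)) := by
              refine mul_le_mul_of_nonneg_left (mul_le_mul_of_nonneg_right ?_ h) hε
              linarith
          _ ≤ ε * n' := mul_le_mul_of_nonneg_left h3 hε
    linarith
  have hgoal : b * ((#J : ℝ) / u + u - b) = b * (u + 1) - b / u * (a + (u - b - t)) := by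
    have : (#J : ℝ) = b * (u + 1) + t - a := by linarith
    rw [this]
    field_simp
    ring
  rw [hgoal]
  linarith

/-- On an `α`-expander the rectangle LP of the gap instance has a solution of linear cost. -/
theorem IsCubicExpander.exists_rectSolution_cost_le [Nonempty V] {α : ℝ} (hα : 0 < α)
    (hG : IsCubicExpander G α) :
    ∃ s : (gapInstance G (hG.connected hα)).RectSolution,
      s.cost ≤ 18 / α * (18 / α + 2) * Fintype.card V := by
  have hα' : 0 < 18 / α := by positivity
  have hu1 : (1 : ℝ) ≤ Fintype.card V := by exact_mod_cast Fintype.card_pos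
  rcases le_total (18 / α) (Fintype.card V) with hu | hu
  · set ε : ℝ := 3 / (α * Fintype.card V) with hε
    have hε0 : 0 ≤ ε := by positivity
    have hε' : 6 * ε ≤ 1 := by
      rw [div_le_iff₀ hα] at hu
      rw [hε, mul_div_assoc', div_le_one (by positivity)]
      linarith
    obtain ⟨s, hs⟩ := exists_rectSolution_of_rectMass_le (hG.connected hα) (P := lazyWalk G ε)
      (fun i v => by unfold lazyWalk; split_ifs <;> linarith) (sum_lazyWalk hG.regular ε)
      (fun v => by simp only [lazyWalk_comm (G := G) ε _ v, sum_lazyWalk hG.regular])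
      fun B hB J => rectMass_lazyWalk_le hα hG hu hB J
    refine ⟨s, hs.trans_le ?_⟩
    simp only [sum_lazyWalk_mul_dist hG.regular, sum_const, card_univ, nsmul_eq_mul]
    have h1 : (Fintype.card V : ℝ) * (3 * ε) = 18 / α * (1 / 2) := by
      rw [hε]; field_simp; norm_num
    rw [h1]
    nlinarith [mul_pos hα' hα']
  · obtain ⟨s, hs⟩ := exists_rectSolution_cost_le_pow (hG.connected hα)
    refine ⟨s, hs.trans ?_⟩
    rw [sq, ← mul_assoc]
    refine mul_le_mul_of_nonneg_right ?_ (by linarith)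
    nlinarith

end LazyWalk

/-! ### Binomial estimates -/

theorem Nat.choose_le_choose_right_of_two_mul_le {n r s : ℕ} (hrs : r ≤ s) (hs : 2 * s ≤ n) :
    n.choose r ≤ n.choose s := by
  induction s, hrs using Nat.le_induction with
  | base => exact le_rfl
  | succ s _ ih =>
    exact (ih (by omega)).trans (Nat.choose_le_succ_of_lt_half_left (by omega))

theorem Nat.two_pow_le_choose {n s : ℕ} (hs : 2 * s ≤ n) : 2 ^ s ≤ n.choose s := by
  refine le_trans ?_ (Nat.choose_le_choose s hs)
  rw [← Nat.centralBinom_eq_two_mul_choose]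
  induction s with
  | zero => simp
  | succ s ih =>
    have h1 := Nat.succ_mul_centralBinom_succ s
    have h2 := ih (by omega)
    refine le_of_mul_le_mul_left (a := s + 1) ?_ (Nat.succ_pos s)
    rw [h1, pow_succ]
    nlinarith

/-- A single term of the expansion of `(8 + 1) ^ (s + r)` bounds the binomial coefficient. -/
theorem Nat.choose_add_sq_le_two_pow {s r : ℕ} (h : 10 * r ≤ s) :
    (s + r).choose s ^ 2 ≤ 2 ^ s := by
  have h1 : 8 ^ s * (s + r).choose s ≤ 9 ^ (s + r) := by
    have h2 := add_pow 8 1 (s + r)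
    norm_num at h2
    rw [h2]
    exact single_le_sum (f := fun k => 8 ^ k * (s + r).choose k) (fun _ _ => Nat.zero_le _)
      (mem_range.2 (by omega))
  have h3 : 81 ^ (s + r) ≤ 128 ^ s := by
    obtain ⟨e, rfl⟩ := Nat.exists_eq_add_of_le h
    calc 81 ^ (10 * r + e + r) = (81 ^ 11) ^ r * 81 ^ e := by rw [← pow_mul, ← pow_add]; ring_nf
      _ ≤ (128 ^ 10) ^ r * 128 ^ e :=
        Nat.mul_le_mul (Nat.pow_le_pow_left (by norm_num) r) (Nat.pow_le_pow_left (by norm_num) e)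
      _ = _ := by rw [← pow_mul, ← pow_add]
  refine le_of_mul_le_mul_left (a := 64 ^ s) ?_ (by positivity)
  calc 64 ^ s * (s + r).choose s ^ 2 = (8 ^ s * (s + r).choose s) ^ 2 := by
        rw [mul_pow, ← pow_mul, mul_comm s 2, pow_mul]; norm_num
    _ ≤ (9 ^ (s + r)) ^ 2 := Nat.pow_le_pow_left h1 2
    _ = 81 ^ (s + r) := by rw [← pow_mul, mul_comm (s + r) 2, pow_mul]; norm_num
    _ ≤ 128 ^ s := h3
    _ = 64 ^ s * 2 ^ s := by rw [← mul_pow]; norm_num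

theorem Nat.choose_add_le_choose_sq {n s r : ℕ} (hr : r ≤ s) (hs : 2 * s ≤ n) :
    n.choose (s + r) ≤ n.choose s ^ 2 := by
  have h1 := Nat.choose_mul (n := n) (k := s + r) (s := s) (Nat.le_add_right s r)
  rw [Nat.add_sub_cancel_left] at h1
  calc n.choose (s + r) ≤ n.choose (s + r) * (s + r).choose s :=
        Nat.le_mul_of_pos_right _ (Nat.choose_pos (Nat.le_add_right s r))
    _ = n.choose s * (n - s).choose r := h1
    _ ≤ n.choose s * n.choose s := Nat.mul_le_mul_left _
        ((Nat.choose_le_choose r (Nat.sub_le n s)).trans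
          (Nat.choose_le_choose_right_of_two_mul_le hr hs))
    _ = _ := (sq _).symm

/-! ### Random permutations expand -/

section Permutations

open Equiv

theorem Equiv.Perm.exists_image_eq {α : Type*} [Fintype α] [DecidableEq α] {S T : Finset α}
    (h : #S = #T) : ∃ τ : Perm α, S.image τ = T := by
  have hcard : Fintype.card {x // x ∈ S} = Fintype.card {x // x ∈ T} := by simpa using h
  let e : {x // x ∈ S} ≃ {x // x ∈ T} := Fintype.equivOfCardEq hcard
  refine ⟨e.extendSubtype, eq_of_subset_of_card_le ?_ ?_⟩
  · intro y hy
    obtain ⟨x, hx, rfl⟩ := mem_image.1 hy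
    exact e.extendSubtype_mem x hx
  · rw [card_image_of_injective _ (Equiv.injective _), h]

/-- A uniformly random permutation maps `S` to a uniformly random set of the same size. -/
theorem Equiv.Perm.card_image_subset_mul_choose {α : Type*} [Fintype α] [DecidableEq α]
    (S T : Finset α) :
    #{π : Perm α | S.image π ⊆ T} * (Fintype.card α).choose #S =
      (#T).choose #S * (Fintype.card α).factorial := by
  have hfiber : ∀ S' : Finset α, #S' = #S →
      #{π : Perm α | S.image π = S'} = #{π : Perm α | S.image π = S} := by
    intro S' hS'
    obtain ⟨τ, hτ⟩ := Equiv.Perm.exists_image_eq hS'.symm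
    refine (card_bij (fun π _ => τ * π) ?_ (fun _ _ _ _ h => mul_left_cancel h) ?_).symm
    · intro π hπ
      rw [mem_filter_univ] at hπ ⊢
      rw [Perm.coe_mul, ← image_image, hπ, hτ]
    · intro π hπ
      rw [mem_filter_univ] at hπ
      refine ⟨τ⁻¹ * π, ?_, by simp⟩
      rw [mem_filter_univ, Perm.coe_mul, ← image_image, hπ, ← hτ, image_image, ← Perm.coe_mul]
      simp
  have hcount : ∀ T' : Finset α, #{π : Perm α | S.image π ⊆ T'} =
      (#T').choose #S * #{π : Perm α | S.image π = S} := by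
    intro T'
    rw [card_eq_sum_card_fiberwise (f := fun π : Perm α => S.image π) (t := T'.powersetCard #S)]
    · rw [← card_powersetCard, ← smul_eq_mul, ← sum_const]
      refine sum_congr rfl fun S' hS' => ?_
      rw [mem_powersetCard] at hS'
      rw [← hfiber S' hS'.2, filter_filter]
      congr 1
      refine filter_congr fun π _ => ⟨fun h => h.2, fun h => ⟨h ▸ hS'.1, h⟩⟩
    · intro π hπ
      simp only [coe_filter, mem_univ, true_and, Set.mem_ofPred_eq] at hπ
      exact mem_coe.2 (mem_powersetCard.2 ⟨hπ, card_image_of_injective _ π.injective⟩)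
  have huniv := hcount univ
  simp only [subset_univ, filter_true, card_univ, Fintype.card_perm] at huniv
  rw [hcount T, huniv]
  ring

theorem card_filter_forall_image_subset {ι α : Type*} [Fintype ι] [DecidableEq ι] [Fintype α]
    [DecidableEq α] (S T : Finset α) :
    #{f : ι → Perm α | ∀ i, S.image (f i) ⊆ T} =
      #{π : Perm α | S.image π ⊆ T} ^ Fintype.card ι := by
  have : ({f : ι → Perm α | ∀ i, S.image (f i) ⊆ T} : Finset _) =
      Fintype.piFinset fun _ => ({π : Perm α | S.image π ⊆ T} : Finset _) := by
    ext f; simp [Fintype.mem_piFinset]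
  rw [this, Fintype.card_piFinset, prod_const, card_univ]

/-- Among the `10`-tuples of permutations of `2 * m` points, those that map a given set size
`s ≤ m` into sets of size `s + s / 10` are rare. -/
theorem sum_card_forall_image_subset_le {m s : ℕ} (hs : 1 ≤ s) (hsm : s ≤ m) :
    ((∑ S ∈ powersetCard s (univ : Finset (Fin (2 * m))),
      ∑ T ∈ powersetCard (s + s / 10) (univ : Finset (Fin (2 * m))),
        #{f : ZMod 10 → Perm (Fin (2 * m)) | ∀ i, S.image (f i) ⊆ T} : ℕ) : ℝ) ≤
      ((2 * m).factorial : ℝ) ^ 10 / (2 * m) ^ 2 := by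
  set C : ℝ := (((2 * m).choose s : ℕ) : ℝ) with hC
  set M : ℝ := (((2 * m).factorial : ℕ) : ℝ) with hM
  have hm : (0 : ℝ) < 2 * m := by
    have : (0 : ℝ) < m := by exact_mod_cast (by omega : 0 < m)
    linarith
  have hCm : 2 * (m : ℝ) ≤ C := by
    have := Nat.choose_le_choose_right_of_two_mul_le hs (by omega : 2 * s ≤ 2 * m)
    rw [Nat.choose_one_right] at this
    rw [hC]
    exact_mod_cast this
  have hC0 : 0 < C := hm.trans_le hCm
  have hM0 : 0 ≤ M := Nat.cast_nonneg _
  have hterm : ∀ S ∈ powersetCard s (univ : Finset (Fin (2 * m))),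
      ∀ T ∈ powersetCard (s + s / 10) (univ : Finset (Fin (2 * m))),
        ((#{f : ZMod 10 → Perm (Fin (2 * m)) | ∀ i, S.image (f i) ⊆ T} : ℕ) : ℝ) ≤
          M ^ 10 / C ^ 5 := by
    intro S hS T hT
    rw [mem_powersetCard_univ] at hS hT
    rw [card_filter_forall_image_subset, ZMod.card]
    have h1 := Equiv.Perm.card_image_subset_mul_choose S T
    rw [Fintype.card_fin, hS, hT] at h1
    set k := #{π : Perm (Fin (2 * m)) | S.image π ⊆ T}
    set c := (s + s / 10).choose s
    have h2 : c ^ 2 ≤ (2 * m).choose s :=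
      (Nat.choose_add_sq_le_two_pow (by omega)).trans (Nat.two_pow_le_choose (by omega))
    have h1' : (k : ℝ) * C = c * M := by rw [hC, hM]; exact_mod_cast h1
    have h2' : (c : ℝ) ^ 2 ≤ C := by rw [hC]; exact_mod_cast h2
    have h3 : (k : ℝ) ^ 2 ≤ M ^ 2 / C := by
      rw [le_div_iff₀ hC0]
      refine le_of_mul_le_mul_right ?_ hC0
      calc (k : ℝ) ^ 2 * C * C = (k * C) ^ 2 := by ring
        _ = c ^ 2 * M ^ 2 := by rw [h1', mul_pow]
        _ ≤ C * M ^ 2 := mul_le_mul_of_nonneg_right h2' (sq_nonneg M)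
        _ = M ^ 2 * C := mul_comm _ _
    calc ((k ^ 10 : ℕ) : ℝ) = ((k : ℝ) ^ 2) ^ 5 := by push_cast; ring
      _ ≤ (M ^ 2 / C) ^ 5 := pow_le_pow_left₀ (sq_nonneg _) h3 5
      _ = _ := by rw [div_pow, ← pow_mul]
  have hT : ((2 * m).choose (s + s / 10) : ℝ) ≤ C ^ 2 := by
    rw [hC]
    exact_mod_cast Nat.choose_add_le_choose_sq (by omega : s / 10 ≤ s) (by omega)
  push_cast
  calc _ ≤ ∑ S ∈ powersetCard s (univ : Finset (Fin (2 * m))),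
        ∑ T ∈ powersetCard (s + s / 10) (univ : Finset (Fin (2 * m))), M ^ 10 / C ^ 5 :=
        sum_le_sum fun S hS => sum_le_sum fun T hT => hterm S hS T hT
    _ = C * ((2 * m).choose (s + s / 10) * (M ^ 10 / C ^ 5)) := by
        simp only [sum_const, card_powersetCard, card_univ, Fintype.card_fin, nsmul_eq_mul, hC]
    _ ≤ C * (C ^ 2 * (M ^ 10 / C ^ 5)) := by gcongr
    _ = M ^ 10 / C ^ 2 := by field_simp
    _ ≤ M ^ 10 / (2 * m) ^ 2 := by gcongr

/-- There are ten permutations of `2 * m` points under which every nonempty set of at most half of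
the points has more than `11 / 10` times as many images as elements. -/
theorem exists_perm_card_lt_card_biUnion_image {m : ℕ} (hm : 0 < m) :
    ∃ f : ZMod 10 → Perm (Fin (2 * m)), ∀ S : Finset (Fin (2 * m)), S.Nonempty → #S ≤ m →
      #S + #S / 10 < #(univ.biUnion fun i => S.image (f i)) := by
  by_contra! hbad
  have hcover : (univ : Finset (ZMod 10 → Perm (Fin (2 * m)))) ⊆
      (Icc 1 m).biUnion fun s => (powersetCard s univ).biUnion fun S =>
        (powersetCard (s + s / 10) univ).biUnion fun T => {f | ∀ i, S.image (f i) ⊆ T} := by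
    intro f _
    obtain ⟨S, hS, hSm, hN⟩ := hbad f
    obtain ⟨T, hNT, hT⟩ := exists_superset_card_eq hN (by rw [Fintype.card_fin]; omega)
    simp only [mem_biUnion, mem_powersetCard_univ, mem_Icc, mem_filter_univ]
    exact ⟨#S, ⟨hS.card_pos, hSm⟩, S, rfl, T, hT, fun i =>
      (subset_biUnion_of_mem (fun i => S.image (f i)) (mem_univ i)).trans hNT⟩
  have hle := (card_le_card hcover).trans <| card_biUnion_le.trans <| sum_le_sum fun s _ =>
    card_biUnion_le.trans <| sum_le_sum fun S _ => card_biUnion_le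
  rw [card_univ, Fintype.card_fun, Fintype.card_perm, Fintype.card_fin, ZMod.card] at hle
  have hm' : (0 : ℝ) < m := by exact_mod_cast hm
  have hm1 : (1 : ℝ) ≤ m := by exact_mod_cast hm
  have hM : (0 : ℝ) < ((2 * m).factorial : ℝ) ^ 10 := by positivity
  have hlt : ((2 * m).factorial : ℝ) ^ 10 ≤ m * (((2 * m).factorial : ℝ) ^ 10 / (2 * m) ^ 2) := by
    have hle' := Nat.cast_le (α := ℝ).2 hle
    rw [Nat.cast_pow, Nat.cast_sum] at hle'
    refine hle'.trans ?_
    refine (sum_le_sum fun s hs => sum_card_forall_image_subset_le (mem_Icc.1 hs).1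
      (mem_Icc.1 hs).2).trans_eq ?_
    rw [sum_const, Nat.card_Icc, Nat.add_sub_cancel, nsmul_eq_mul]
  rw [mul_div_assoc', le_div_iff₀ (by positivity)] at hlt
  nlinarith [mul_pos hM hm']

end Permutations

/-! ### Cubic expanders of unbounded size -/

section CloudGraph

open Equiv

variable {W : Type*}

/-- The matching between the left copy (`false`) and the right copy (`true`) of `W × ZMod 10` that
joins `(v, i)` on the left to `(f i v, i)` on the right, as an involution. -/
def matchingPartner (f : ZMod 10 → Perm W) (x : Bool × W × ZMod 10) : Bool × W × ZMod 10 :=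
  (!x.1, bif x.1 then (f x.2.2).symm x.2.1 else f x.2.2 x.2.1, x.2.2)

theorem matchingPartner_matchingPartner (f : ZMod 10 → Perm W) (x : Bool × W × ZMod 10) :
    matchingPartner f (matchingPartner f x) = x := by
  obtain ⟨_ | _, v, i⟩ := x <;> simp [matchingPartner]

/-- The replacement product of the bipartite multigraph `v ↦ f i v` (`i : ZMod 10`) on two copies of
`W` with a cycle of length `10`: each vertex `(b, v)` of the multigraph becomes a cycle on the
vertices `(b, v, i)`, and the edge with label `i` is attached at position `i`. -/
def cloudGraph (f : ZMod 10 → Perm W) : SimpleGraph (Bool × W × ZMod 10) where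
  Adj x y := (x.1 = y.1 ∧ x.2.1 = y.2.1 ∧ (y.2.2 = x.2.2 + 1 ∨ x.2.2 = y.2.2 + 1)) ∨
    y = matchingPartner f x
  symm := ⟨fun x y h => by
    rcases h with ⟨h1, h2, h3⟩ | rfl
    · exact Or.inl ⟨h1.symm, h2.symm, h3.symm⟩
    · exact Or.inr (matchingPartner_matchingPartner f x).symm⟩
  loopless := ⟨fun x h => by
    rcases h with ⟨_, _, h | h⟩ | h
    · exact absurd (left_eq_add.1 h) (by decide)
    · exact absurd (left_eq_add.1 h) (by decide)
    · have := congrArg Prod.fst h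
      simp [matchingPartner] at this⟩

theorem cloudGraph_adj {f : ZMod 10 → Perm W} {x y : Bool × W × ZMod 10} :
    (cloudGraph f).Adj x y ↔
      (x.1 = y.1 ∧ x.2.1 = y.2.1 ∧ (y.2.2 = x.2.2 + 1 ∨ x.2.2 = y.2.2 + 1)) ∨
        y = matchingPartner f x :=
  Iff.rfl

variable [Fintype W] [DecidableEq W]

theorem cloudGraph_isRegularOfDegree (f : ZMod 10 → Perm W) [DecidableRel (cloudGraph f).Adj] :
    (cloudGraph f).IsRegularOfDegree 3 := by
  intro x
  have hN : (cloudGraph f).neighborFinset x =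
      {(x.1, x.2.1, x.2.2 + 1), (x.1, x.2.1, x.2.2 - 1), matchingPartner f x} := by
    ext ⟨b, v, i⟩
    rw [SimpleGraph.mem_neighborFinset, cloudGraph_adj]
    simp only [mem_insert, mem_singleton, Prod.mk.injEq]
    constructor
    · rintro (⟨rfl, rfl, rfl | h⟩ | h)
      · simp
      · simp [h]
      · exact Or.inr (Or.inr h)
    · rintro (⟨rfl, rfl, rfl⟩ | ⟨rfl, rfl, rfl⟩ | h)
      · simp
      · simp
      · exact Or.inr h
  rw [← SimpleGraph.card_neighborFinset_eq_degree, hN]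
  refine card_eq_three.2 ⟨_, _, _, ?_, ?_, ?_, rfl⟩
  · intro h
    simp only [Prod.mk.injEq, true_and] at h
    rw [sub_eq_add_neg, add_right_inj] at h
    exact absurd h (by decide)
  · intro h
    simpa [matchingPartner] using congrArg Prod.fst h
  · intro h
    simpa [matchingPartner] using congrArg Prod.fst h

theorem exists_mem_add_one_notMem {A : ZMod 10 → Prop} (h : ∃ i, A i) (h' : ∃ i, ¬ A i) :
    ∃ i, A i ∧ ¬ A (i + 1) := by
  by_contra! hstep
  obtain ⟨i, hi⟩ := h
  obtain ⟨j, hj⟩ := h'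
  have hall : ∀ k : ℕ, A (i + k) := by
    intro k
    induction k with
    | zero => simpa using hi
    | succ k ih => simpa [add_assoc] using hstep _ ih
  have := hall (j - i).val
  rw [ZMod.natCast_zmod_val, add_sub_cancel] at this
  exact hj this

/-- Vertex expansion of the permutations gives edge expansion of the cubic graph: a cycle that is
cut by `X` contributes an edge of it to the boundary, and the cycles inside `X` expand along the
matching. With `e` boundary edges there are at most `e` cut cycles and `82 * e` full ones, each with
`10` vertices. -/
theorem card_le_card_interedges_cloudGraph {m : ℕ} {f : ZMod 10 → Perm (Fin (2 * m))}
    (hf : ∀ S : Finset (Fin (2 * m)), S.Nonempty → #S ≤ m →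
      #S + #S / 10 < #(univ.biUnion fun i => S.image (f i)))
    [DecidableRel (cloudGraph f).Adj] (X : Finset (Bool × Fin (2 * m) × ZMod 10))
    (hX : 2 * #X ≤ Fintype.card (Bool × Fin (2 * m) × ZMod 10)) :
    #X ≤ 830 * #((cloudGraph f).interedges X Xᶜ) := by
  classical
  set E := (cloudGraph f).interedges X Xᶜ with hE
  -- `S` and `T` are the full cycles on the left and on the right, `Q` the cut cycles.
  set S : Finset (Fin (2 * m)) := {v | ∀ i, (false, v, i) ∈ X} with hS
  set T : Finset (Fin (2 * m)) := {v | ∀ i, (true, v, i) ∈ X} with hT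
  set Q : Finset (Bool × Fin (2 * m)) :=
    {c | (∃ i, (c.1, c.2, i) ∈ X) ∧ ∃ i, (c.1, c.2, i) ∉ X} with hQ
  have hQE : #Q ≤ #E := by
    have : ∀ c ∈ Q, ∃ i, (c.1, c.2, i) ∈ X ∧ (c.1, c.2, i + 1) ∉ X := fun c hc =>
      exists_mem_add_one_notMem (mem_filter.1 hc).2.1 (mem_filter.1 hc).2.2
    choose! i hi hi' using this
    refine card_le_card_of_injOn
      (fun c => ((c.1, c.2, i c), (c.1, c.2, i c + 1))) (fun c hc => ?_) fun c _ c' _ h => ?_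
    · rw [mem_coe, hE, SimpleGraph.mk_mem_interedges_iff, mem_compl]
      exact ⟨hi c hc, hi' c hc, Or.inl ⟨rfl, rfl, Or.inl rfl⟩⟩
    · simp only [Prod.mk.injEq] at h
      exact Prod.ext h.1.1 h.1.2.1
  have hQside : ∀ b : Bool, #{v | (b, v) ∈ Q} ≤ #Q := fun b =>
    card_le_card_of_injOn (Prod.mk b) (fun v hv => by simpa using hv)
      fun v _ w _ h => (Prod.mk.inj h).2
  have hout : ∀ b v, (b, v) ∉ Q → ¬ (∀ i, (b, v, i) ∈ X) → ∀ i, (b, v, i) ∉ X := by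
    intro b v hQ' hfull i hi
    push Not at hfull
    exact hQ' (by rw [hQ, mem_filter_univ]; exact ⟨⟨i, hi⟩, hfull⟩)
  set N := univ.biUnion fun i => S.image (f i) with hN
  have hNT : #N ≤ #T + #Q + #E := by
    have h1 : #(N \ (T ∪ ({v | (true, v) ∈ Q} : Finset _))) ≤ #E := by
      have : ∀ w ∈ N \ (T ∪ ({v | (true, v) ∈ Q} : Finset _)), ∃ i, (f i).symm w ∈ S := by
        intro w hw
        rw [mem_sdiff, hN, mem_biUnion] at hw
        obtain ⟨⟨i, _, hi⟩, _⟩ := hw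
        obtain ⟨v, hv, rfl⟩ := mem_image.1 hi
        exact ⟨i, by simpa using hv⟩
      choose! i hi using this
      refine card_le_card_of_injOn (fun w => ((false, (f (i w)).symm w, i w), (true, w, i w)))
        (fun w hw => ?_) fun w _ w' _ h => ?_
      · have hv := hi w hw
        simp only [hS, mem_filter_univ] at hv
        simp only [mem_coe, mem_sdiff, mem_union, hT, mem_filter_univ, not_or] at hw
        rw [mem_coe, hE, SimpleGraph.mk_mem_interedges_iff, mem_compl]
        exact ⟨hv _, hout _ _ hw.2.2 hw.2.1 _, Or.inr (by simp [matchingPartner])⟩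
      · simp only [Prod.mk.injEq] at h
        exact h.2.2.1
    have h2 := le_card_sdiff (T ∪ ({v | (true, v) ∈ Q} : Finset _)) N
    have h3 := card_union_le T ({v | (true, v) ∈ Q} : Finset _)
    have h4 := hQside true
    omega
  have hTS : #T ≤ #S + #Q + #E := by
    set R : Finset (Fin (2 * m)) := (S ∪ ({v | (false, v) ∈ Q} : Finset _)).image (f 0) with hR
    have h1 : #(T \ R) ≤ #E := by
      refine card_le_card_of_injOn (fun w => ((true, w, 0), (false, (f 0).symm w, 0)))
        (fun w hw => ?_) fun w _ w' _ h => ?_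
      · rw [mem_coe, mem_sdiff, hR, mem_image] at hw
        obtain ⟨hwT, hwR⟩ := hw
        have hv : (f 0).symm w ∉ S ∪ ({v | (false, v) ∈ Q} : Finset _) := fun h =>
          hwR ⟨_, h, by simp⟩
        simp only [mem_union, hS, mem_filter_univ, not_or] at hv
        simp only [hT, mem_filter_univ] at hwT
        rw [mem_coe, hE, SimpleGraph.mk_mem_interedges_iff, mem_compl]
        exact ⟨hwT 0, hout _ _ hv.2 hv.1 _, Or.inr (by simp [matchingPartner])⟩
      · simp only [Prod.mk.injEq] at h
        exact h.1.2.1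
    have h2 := le_card_sdiff R T
    have h3 : #R ≤ _ := card_image_le
    have h4 := card_union_le S ({v | (false, v) ∈ Q} : Finset _)
    have h5 := hQside false
    omega
  set F : Finset (Bool × Fin (2 * m)) := {c | ∀ i, (c.1, c.2, i) ∈ X} with hF
  have hFcard : #F = #S + #T := by
    simp only [hF, hS, hT, card_filter, Fintype.sum_prod_type, Fintype.sum_bool]
    exact add_comm _ _
  have hlow : #F * 10 ≤ #X := by
    have : #(F ×ˢ (univ : Finset (ZMod 10))) ≤ #X := by
      refine card_le_card_of_injOn (fun c => (c.1.1, c.1.2, c.2)) (fun c hc => ?_)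
        fun c _ c' _ h => ?_
      · rw [mem_coe, mem_product, hF, mem_filter_univ] at hc
        exact hc.1 c.2
      · simp only [Prod.mk.injEq] at h
        exact Prod.ext (Prod.ext h.1 h.2.1) h.2.2
    rwa [card_product, card_univ, ZMod.card] at this
  have hupp : #X ≤ (#F + #Q) * 10 := by
    have : #X ≤ #((F ∪ Q) ×ˢ (univ : Finset (ZMod 10))) := by
      refine card_le_card_of_injOn (fun x => ((x.1, x.2.1), x.2.2)) (fun x hx => ?_)
        fun x _ x' _ h => ?_
      · rw [mem_coe, mem_product, mem_union]
        refine ⟨?_, mem_univ _⟩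
        by_cases hfull : ∀ i, (x.1, x.2.1, i) ∈ X
        · exact Or.inl (by rw [hF, mem_filter_univ]; exact hfull)
        · push Not at hfull
          exact Or.inr (by rw [hQ, mem_filter_univ]; exact ⟨⟨x.2.2, hx⟩, hfull⟩)
      · simp only [Prod.mk.injEq] at h
        exact Prod.ext h.1.1 (Prod.ext h.1.2 h.2)
    rw [card_product, card_univ, ZMod.card] at this
    exact this.trans (Nat.mul_le_mul_right _ (card_union_le _ _))
  rw [Fintype.card_prod, Fintype.card_prod, Fintype.card_bool, Fintype.card_fin, ZMod.card] at hX
  rcases Nat.lt_or_ge m #S with hSm | hSm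
  · -- A subset of `S` of size `m` already has more than `#T` images.
    obtain ⟨S', hS', hS'm⟩ := exists_subset_card_eq hSm.le
    have hsub : (univ.biUnion fun i => S'.image (f i)) ⊆ N :=
      biUnion_mono fun i _ => image_subset_image hS'
    have h1 := card_le_card hsub
    rcases Nat.eq_zero_or_pos m with rfl | hm
    · omega
    · have h2 := hf S' (card_pos.1 (by omega)) hS'm.le
      omega
  · rcases S.eq_empty_or_nonempty with hempty | hne
    · rw [hempty, card_empty] at hTS hFcard
      omega
    · have h2 := hf S hne hSm
      rw [← hN] at h2
      omega

end CloudGraph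

theorem exists_isCubicExpander (N : ℕ) :
    ∃ (V : Type) (_ : Fintype V) (_ : DecidableEq V) (_ : Nonempty V) (G : SimpleGraph V)
      (_ : DecidableRel G.Adj), IsCubicExpander G (1 / 830) ∧ N ≤ Fintype.card V := by
  classical
  obtain ⟨f, hf⟩ := exists_perm_card_lt_card_biUnion_image (Nat.succ_pos N)
  refine ⟨Bool × Fin (2 * (N + 1)) × ZMod 10, inferInstance, inferInstance,
    ⟨(true, 0, 0)⟩, cloudGraph f, inferInstance,
    ⟨cloudGraph_isRegularOfDegree f, fun X hX => ?_⟩, ?_⟩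
  · have h := card_le_card_interedges_cloudGraph hf X hX
    have h' : (#X : ℝ) ≤ 830 * #((cloudGraph f).interedges X Xᶜ) := by exact_mod_cast h
    linarith
  · rw [Fintype.card_prod, Fintype.card_prod, Fintype.card_bool, Fintype.card_fin, ZMod.card]
    omega

/-! ### The integrality gap -/

/-- All clients can be served from one location at which all facilities are opened. -/
theorem nonempty_integralSolution {V : Type*} [Fintype V] [Nonempty V] {G : SimpleGraph V}
    (hG : G.Connected) : Nonempty (gapInstance G hG).IntegralSolution := by
  classical
  obtain ⟨v₀⟩ := ‹Nonempty V›
  refine ⟨{ opened := fun v => if v = v₀ then Fintype.card V + 1 else 0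
            assign := fun _ => v₀
            cardinality := by simp [gapInstance]
            capacity := fun i => ?_ }⟩
  by_cases h : v₀ = i
  · subst h
    simp [gapInstance]
  · simp [h]

theorem CapKMedian.le_rectGap {F C : Type*} [Fintype F] [Fintype C] {I : CapKMedian F C}
    {a b : ℝ} (hb : 0 < b) (s : I.RectSolution) (hs : s.cost ≤ b)
    (h : ∀ s : I.IntegralSolution, a ≤ s.cost) : ENNReal.ofReal (a / b) ≤ I.rectGap := by
  rw [ENNReal.ofReal_div_of_pos hb]
  exact ENNReal.div_le_div (le_iInf fun s => ENNReal.ofReal_le_ofReal (h s))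
    ((iInf_le _ s).trans (ENNReal.ofReal_le_ofReal hs))

theorem mainTheorem3 :
    (∃ c : ℝ, 0 < c ∧ ∀ (α : ℝ) (hα : 0 < α), ∃ K : ℝ, 0 < K ∧
      ∀ (V : Type) [Fintype V] [DecidableEq V] [Nonempty V] (G : SimpleGraph V)
        [DecidableRel G.Adj] (hG : IsCubicExpander G α),
        Nonempty (gapInstance G (hG.connected hα)).IntegralSolution ∧
        (∃ s : (gapInstance G (hG.connected hα)).RectSolution,
          s.cost ≤ K * (Fintype.card V : ℝ)) ∧
        (∀ s : (gapInstance G (hG.connected hα)).IntegralSolution,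
          c * ((Fintype.card V : ℝ) * Real.log (Fintype.card V : ℝ)) ≤ s.cost)) ∧
    (∃ (c : ℝ) (_ : 0 < c) (α : ℝ) (hα : 0 < α), ∀ N : ℕ,
      ∃ (V : Type) (_ : Fintype V) (_ : DecidableEq V) (_ : Nonempty V) (G : SimpleGraph V)
        (_ : DecidableRel G.Adj) (hG : IsCubicExpander G α),
        N ≤ Fintype.card V ∧
        Nonempty (gapInstance G (hG.connected hα)).IntegralSolution ∧
        ENNReal.ofReal
            (c * Real.log ((Fintype.card V : ℝ) * ((Fintype.card V : ℝ) + 1))) ≤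
          (gapInstance G (hG.connected hα)).rectGap) := by
  have hc : (0 : ℝ) < 1 / (2 * Real.log 16) := by
    have := Real.log_pos (by norm_num : (1 : ℝ) < 16)
    positivity
  set c : ℝ := 1 / (2 * Real.log 16) with hcdef
  refine ⟨⟨c, hc, fun α hα => ⟨18 / α * (18 / α + 2), by positivity, ?_⟩⟩, ?_⟩
  · intro V _ _ _ G _ hG
    exact ⟨nonempty_integralSolution _, hG.exists_rectSolution_cost_le hα,
      fun s => s.le_cost fun v => (hG.regular v).le⟩
  · set α : ℝ := 1 / 830
    have hα : 0 < α := by norm_num [α]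
    set K : ℝ := 18 / α * (18 / α + 2)
    have hK : 0 < K := by positivity
    refine ⟨c / (3 * K), by positivity, α, hα, fun N => ?_⟩
    obtain ⟨V, _, _, _, G, _, hG, hN⟩ := exists_isCubicExpander (max N 2)
    refine ⟨V, _, _, _, G, _, hG, (le_max_left _ _).trans hN, nonempty_integralSolution _, ?_⟩
    obtain ⟨s, hs⟩ := hG.exists_rectSolution_cost_le hα
    have hu2 : (2 : ℝ) ≤ Fintype.card V := by exact_mod_cast (le_max_right _ _).trans hN
    have hu0 : (0 : ℝ) < Fintype.card V := by linarith
    refine le_trans (ENNReal.ofReal_le_ofReal ?_)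
      (CapKMedian.le_rectGap (b := K * Fintype.card V) (by positivity) s hs
        fun s => s.le_cost fun v => (hG.regular v).le)
    rw [← hcdef]
    have hlog : Real.log ((Fintype.card V : ℝ) * (Fintype.card V + 1)) ≤
        3 * Real.log (Fintype.card V) := by
      rw [show (3 : ℝ) = ((3 : ℕ) : ℝ) by norm_num, ← Real.log_pow]
      refine Real.log_le_log (by positivity) ?_
      nlinarith [mul_pos hu0 hu0]
    calc c / (3 * K) * Real.log ((Fintype.card V : ℝ) * (Fintype.card V + 1)) ≤
          c / (3 * K) * (3 * Real.log (Fintype.card V)) :=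
          mul_le_mul_of_nonneg_left hlog (by positivity)
      _ = _ := by field_simp
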